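/- Let $A\in\mathbb R^{n_x\times n_x}$, $B\in\mathbb R^{n_x\times n_w}$, $C\in\mathbb R^{n_y\times n_x}$, $D\in\mathbb R^{n_y\times n_w}$, $A_m\in\mathbb R^{n_m\times n_m}$, $B_m\in\mathbb R^{n_m\times n_v}$, $C_m\in\mathbb R^{n_w\times n_m}$, $D_m\in\mathbb R^{n_w\times n_v}$, and consider the plant with exogenous input model $$\dot x=Ax+g_x(t,y)+Bw,\quad y=Cx+g_y(t,y)+Dw,\qquad \dot x_m=A_mx_m+B_mv,\quad w=C_mx_m+D_mv,$$ with unknown input $v$. Put $\xi=\begin{bmatrix}x\\x_m\end{bmatrix}$ and $$\mathcal A=\begin{bmatrix}A&BC_m\\0&A_m\end{bmatrix},\quad \mathcal B=\begin{bmatrix}BD_m\\B_m\end{bmatrix},\quad \mathcal C=\begin{bmatrix}C&DC_m\end{bmatrix},\quad \mathcal D=DD_m .$$ For a gain matrix $L_1\in\mathbb R^{(n_x+n_m)\times n_y}$, the observer $\dot{\hat\xi}=\mathcal A\hat\xi+\begin{bmatrix}g_x(t,y)\\0\end{bmatrix}+L_1(\hat y-y)$, $\hat y=\mathcal C\hat\xi+g_y(t,y)$,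 has the error dynamics (with $e=\hat\xi-\xi$) $$\dot e=(\mathcal A+L_1\mathcal C)e-(\mathcal B+L_1\mathcal D)v. \qquad (*)$$ A pair $(A,C)$ is called detectable if $\begin{bmatrix}A-\lambda I\\C\end{bmatrix}$ has full column rank for every $\lambda\in\mathbb C$ with $\operatorname{Re}\lambda\ge 0$. A signal $s$ on $[t_0,\infty)$ is $\mathcal L_2$ if it is measurable and $\|s(\cdot)\|_2=\bigl(\int_{t_0}^\infty\|s(t)\|^2\,dt\bigr)^{1/2}<\infty$, where $\|s(t)\|$ is the Euclidean norm. Solutions of differential equations are understood in the Carathéodory sense. A system $\dot e=F(t,e,v)$, $z=G(t,e,v)$ is called (globally uniformly) $\mathcal L_2$-stable with performance level $\gamma\ge 0$ if for all $t_0\in\mathbb R$, all initial states $e_0$ and all $\mathcal L_2$ inputs $v:[t_0,\infty)\to\mathbb R^{n_v}$ it has a solution on $[t_0,\infty)$ with $e(t_0)=e_0$, and 1. there are constants $c,\alpha>0$ such that for $v\equiv 0$ all solutions, for all $t_0$, satisfy $\|e(t)\|\le c\,e^{-\alpha(t-t_0)}\|e(t_0)\|$ for $t\ge t_0$; 2.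 there is a real-valued function $\beta_1$ such that for all $t_0$, all $\mathcal L_2$ inputs $v$ and all solutions, $\|e(t)\|\le\beta_1(e(t_0),\|v(\cdot)\|_2)$ for $t\ge t_0$; 3. there is a real-valued function $\beta_2$ such that for all $t_0$, all $\mathcal L_2$ inputs $v$ and all solutions, $z$ is $\mathcal L_2$ with $\|z(\cdot)\|_2\le\beta_2(e(t_0),\|v(\cdot)\|_2)$, and $\beta_2(0,\|v(\cdot)\|_2)\le\gamma\|v(\cdot)\|_2$. **Theorem.** Suppose that $(A,C)$ and $(A_m,C_m)$ are detectable and that the matrix $$\begin{bmatrix}A-\lambda I&B\\C&D\end{bmatrix}$$ has full column rank for every eigenvalue $\lambda\in\mathbb C$ of $A_m$ with $\operatorname{Re}\lambda\ge0$. Then for every matrix $H\in\mathbb R^{n_z\times(n_x+n_m)}$ there exist an observer gain $L_1\in\mathbb R^{(n_x+n_m)\times n_y}$ and a finite $\gamma\ge 0$ such that the error dynamics $(*)$ with performance output $z=He$ are $\mathcal L_2$-stable with performance level $\gamma$. -/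

import Mathlib

open MeasureTheory

noncomputable section

/-! ## Matrices: full column rank, detectability, the augmented plant -/

/-- The entrywise complexification of a real matrix. -/
def complexify {m n : Type*} (M : Matrix m n ℝ) : Matrix m n ℂ :=
  M.map (fun a : ℝ => (a : ℂ))

/-- A complex matrix has full column rank. -/
def HasFullColumnRank {m n : Type*} [Fintype n] (M : Matrix m n ℂ) : Prop :=
  M.rank = Fintype.card n

/-- The pair `(A, C)` is detectable: `[A - lam I; C]` has full column rank for every complex `lam`
with nonnegative real part. -/
def IsDetectable {n p : Type*} [Fintype n] [DecidableEq n]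
    (A : Matrix n n ℝ) (C : Matrix p n ℝ) : Prop :=
  ∀ lam : ℂ, 0 ≤ lam.re →
    HasFullColumnRank (Matrix.fromRows (complexify A - lam • (1 : Matrix n n ℂ)) (complexify C))

/-- `[A - lam I, B; C, D]` has full column rank for every (complex) eigenvalue `lam` of `Am` with
nonnegative real part. -/
def RankConditionAtUnstableModes {n m p q : Type*} [Fintype n] [DecidableEq n]
    [Fintype m] [DecidableEq m] [Fintype q]
    (A : Matrix n n ℝ) (B : Matrix n q ℝ) (C : Matrix p n ℝ) (D : Matrix p q ℝ)
    (Am : Matrix m m ℝ) : Prop :=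
  ∀ lam : ℂ, Module.End.HasEigenvalue (Matrix.toLin' (complexify Am)) lam → 0 ≤ lam.re →
    HasFullColumnRank
      (Matrix.fromBlocks (complexify A - lam • (1 : Matrix n n ℂ)) (complexify B)
        (complexify C) (complexify D))

/-- State matrix `[A, B Cm; 0, Am]` of the augmented plant. -/
def augA {n m q : Type*} [Fintype q] (A : Matrix n n ℝ) (B : Matrix n q ℝ)
    (Am : Matrix m m ℝ) (Cm : Matrix q m ℝ) : Matrix (n ⊕ m) (n ⊕ m) ℝ :=
  Matrix.fromBlocks A (B * Cm) 0 Am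

/-- Input matrix `[B Dm; Bm]` of the augmented plant. -/
def augB {n m q r : Type*} [Fintype q] (B : Matrix n q ℝ)
    (Bm : Matrix m r ℝ) (Dm : Matrix q r ℝ) : Matrix (n ⊕ m) r ℝ :=
  Matrix.fromRows (B * Dm) Bm

/-- Output matrix `[C, D Cm]` of the augmented plant. -/
def augC {n m p q : Type*} [Fintype q] (C : Matrix p n ℝ) (D : Matrix p q ℝ)
    (Cm : Matrix q m ℝ) : Matrix p (n ⊕ m) ℝ :=
  Matrix.fromCols C (D * Cm)

/-- Feedthrough matrix `D Dm` of the augmented plant. -/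
def augD {p q r : Type*} [Fintype q] (D : Matrix p q ℝ) (Dm : Matrix q r ℝ) : Matrix p r ℝ :=
  D * Dm

/-! ## `L₂` signals and `L₂`-stability of input-output systems -/

/-- `s` is an `L₂` signal on `[t₀, ∞)`; only the values of `s` on `[t₀, ∞)` matter. -/
def IsL2Signal {E : Type*} [NormedAddCommGroup E] (t₀ : ℝ) (s : ℝ → E) : Prop :=
  MemLp s 2 (volume.restrict (Set.Ici t₀))

/-- The `L₂` norm `(∫_{t₀}^∞ ‖s t‖² dt)^{1/2}` of a signal on `[t₀, ∞)`. -/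
def l2Norm {E : Type*} [NormedAddCommGroup E] (t₀ : ℝ) (s : ℝ → E) : ℝ :=
  Real.sqrt (∫ t in Set.Ici t₀, ‖s t‖ ^ 2)

/-- `e` is a (Carathéodory) solution of `ė = F (t, e, v)` on `[t₀, ∞)`, written as an integral
equation: the input `v` is merely an `L₂` signal, so `e` is differentiable only almost
everywhere. -/
structure IsSolution {E V : Type*} [NormedAddCommGroup E] [NormedSpace ℝ E]
    (F : ℝ → E → V → E) (t₀ : ℝ) (v : ℝ → V) (e : ℝ → E) : Prop where
  continuousOn : ContinuousOn e (Set.Ici t₀)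
  intervalIntegrable : ∀ t, t₀ ≤ t →
    IntervalIntegrable (fun s => F s (e s) (v s)) volume t₀ t
  integral_eq : ∀ t, t₀ ≤ t → e t = e t₀ + ∫ s in t₀..t, F s (e s) (v s)

/-- The system `ė = F (t, e, v)`, `z = G (t, e, v)` is globally uniformly `L₂`-stable with
performance level `gam ≥ 0`. -/
structure IsL2Stable {E V Z : Type*} [NormedAddCommGroup E] [NormedSpace ℝ E]
    [NormedAddCommGroup V] [NormedAddCommGroup Z]
    (F : ℝ → E → V → E) (G : ℝ → E → V → Z) (gam : ℝ) : Prop where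
  nonneg : 0 ≤ gam
  /-- Well-posedness: every initial condition and every `L₂` input admit a solution on
  `[t₀, ∞)`. -/
  exists_solution : ∀ (t₀ : ℝ) (e₀ : E) (v : ℝ → V), IsL2Signal t₀ v →
    ∃ e : ℝ → E, IsSolution F t₀ v e ∧ e t₀ = e₀
  /-- Global uniform exponential stability with zero input. -/
  exponentially_stable : ∃ c rate : ℝ, 0 < c ∧ 0 < rate ∧
    ∀ (t₀ : ℝ) (e : ℝ → E), IsSolution F t₀ (fun _ => (0 : V)) e →
      ∀ t, t₀ ≤ t → ‖e t‖ ≤ c * Real.exp (-rate * (t - t₀)) * ‖e t₀‖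
  /-- Global uniform boundedness of the state. -/
  bounded_state : ∃ β₁ : E → ℝ → ℝ,
    ∀ (t₀ : ℝ) (v : ℝ → V), IsL2Signal t₀ v → ∀ e : ℝ → E, IsSolution F t₀ v e →
      ∀ t, t₀ ≤ t → ‖e t‖ ≤ β₁ (e t₀) (l2Norm t₀ v)
  /-- Output response. -/
  output_response : ∃ β₂ : E → ℝ → ℝ,
    (∀ (t₀ : ℝ) (v : ℝ → V), IsL2Signal t₀ v → ∀ e : ℝ → E, IsSolution F t₀ v e →
      IsL2Signal t₀ (fun t => G t (e t) (v t)) ∧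
        l2Norm t₀ (fun t => G t (e t) (v t)) ≤ β₂ (e t₀) (l2Norm t₀ v)) ∧
    ∀ (t₀ : ℝ) (v : ℝ → V), IsL2Signal t₀ v → β₂ 0 (l2Norm t₀ v) ≤ gam * l2Norm t₀ v

/-! ## The observer error dynamics -/

/-- Right-hand side of the error dynamics `ė = (𝒜 + L₁ 𝒞) e - (ℬ + L₁ 𝒟) v` for an augmented plant
`(𝒜, ℬ, 𝒞, 𝒟)` and an observer gain `L₁`. -/
def errorField {n p r : Type*} [Fintype n] [DecidableEq n] [Fintype p] [DecidableEq p]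
    [Fintype r] [DecidableEq r]
    (𝒜 : Matrix n n ℝ) (ℬ : Matrix n r ℝ) (𝒞 : Matrix p n ℝ) (𝒟 : Matrix p r ℝ)
    (L₁ : Matrix n p ℝ) (_t : ℝ) (e : EuclideanSpace ℝ n) (v : EuclideanSpace ℝ r) :
    EuclideanSpace ℝ n :=
  Matrix.toEuclideanLin (𝒜 + L₁ * 𝒞) e - Matrix.toEuclideanLin (ℬ + L₁ * 𝒟) v

/-- The performance output `z = H e`. -/
def performanceOutput {n r k : Type*} [Fintype n] [DecidableEq n] (H : Matrix k n ℝ)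
    (_t : ℝ) (e : EuclideanSpace ℝ n) (_v : EuclideanSpace ℝ r) : EuclideanSpace ℝ k :=
  Matrix.toEuclideanLin H e

/-- `errorField` is the observer's right-hand side `𝒜 ξ' + g + L₁ (y' - y)` minus the plant's
`𝒜 ξ + g + ℬ v`, where `y = 𝒞 ξ + h + 𝒟 v` and `y' = 𝒞 ξ' + h`, at the error `e = ξ' - ξ`; the
known terms `g`, `h` cancel. -/
theorem errorField_eq {n p r : Type*} [Fintype n] [DecidableEq n] [Fintype p] [DecidableEq p]
    [Fintype r] [DecidableEq r]
    (𝒜 : Matrix n n ℝ) (ℬ : Matrix n r ℝ) (𝒞 : Matrix p n ℝ) (𝒟 : Matrix p r ℝ)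
    (L₁ : Matrix n p ℝ) (t : ℝ) (ξ ξ' g : EuclideanSpace ℝ n) (v : EuclideanSpace ℝ r)
    (h y y' : EuclideanSpace ℝ p)
    (hy : y = Matrix.toEuclideanLin 𝒞 ξ + h + Matrix.toEuclideanLin 𝒟 v)
    (hy' : y' = Matrix.toEuclideanLin 𝒞 ξ' + h) :
    (Matrix.toEuclideanLin 𝒜 ξ' + g + Matrix.toEuclideanLin L₁ (y' - y)) -
        (Matrix.toEuclideanLin 𝒜 ξ + g + Matrix.toEuclideanLin ℬ v)
      = errorField 𝒜 ℬ 𝒞 𝒟 L₁ t (ξ' - ξ) v := by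
  subst hy hy'
  ext i
  simp only [errorField, Matrix.toEuclideanLin, Matrix.ofLp_toLpLin, Matrix.toLin'_apply,
    WithLp.ofLp_add, WithLp.ofLp_sub, Matrix.mulVec_add,
    Matrix.mulVec_sub, Matrix.add_mulVec, ← Matrix.mulVec_mulVec, Pi.add_apply, Pi.sub_apply]
  ring

end

section LinearAlgebra

open Matrix

/-! ## Detectability and quadratic Lyapunov functions -/

/-! A quadratic Lyapunov function for `𝒜 + L₁ 𝒞` suffices: integrating the derivative of ⟨Pe, e⟩
along a solution and absorbing the input term by Young's inequality bounds both the state and the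
energy of e, so a finite γ exists whatever H, ℬ and 𝒟 are (`isL2Stable_of_lyapunov`).

Such a function exists once the augmented pair is detectable. That is a kernel computation
(`isDetectable_augmented`): an unobservable unstable mode (v, w) with w ≠ 0 is an unstable mode of
the input model, where the rank condition and detectability of (Am, Cm) exclude it; with w = 0 it
contradicts detectability of (A, C).

Detectability yields P and L by convex duality (`IsDetectable.exists_lyapunov`). In the variables P
and Y = PL the Lyapunov inequality is linear. If it is infeasible, Hahn–Banach gives a nonzero
positive semidefinite Z with CZ = 0 and AZ + ZAᵀ positive semidefinite. The range of Z is then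
A-invariant and contained in ker C, and A has nonnegative trace on it, hence an eigenvalue there
with nonnegative real part: an unobservable unstable mode (`not_isDetectable_of_posSemidef`). -/

theorem hasFullColumnRank_iff {m n : Type*} [Fintype n] (M : Matrix m n ℂ) :
    HasFullColumnRank M ↔ ∀ v, M *ᵥ v = 0 → v = 0 := by
  classical
  unfold HasFullColumnRank Matrix.rank
  have h := LinearMap.finrank_range_add_finrank_ker M.mulVecLin
  rw [Module.finrank_fintype_fun_eq_card] at h
  have h2 : (∀ v, M *ᵥ v = 0 → v = 0) ↔ LinearMap.ker M.mulVecLin = ⊥ := by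
    rw [LinearMap.ker_eq_bot']; rfl
  rw [h2, ← Submodule.finrank_eq_zero]
  omega

/-! ### Detectability of the augmented plant -/

theorem isDetectable_iff {n p : Type*} [Fintype n] [DecidableEq n]
    (A : Matrix n n ℝ) (C : Matrix p n ℝ) :
    IsDetectable A C ↔ ∀ lam : ℂ, 0 ≤ lam.re → ∀ v : n → ℂ,
      complexify A *ᵥ v = lam • v → complexify C *ᵥ v = 0 → v = 0 := by
  unfold IsDetectable
  refine forall_congr' fun lam => forall_congr' fun _ => ?_
  rw [hasFullColumnRank_iff]
  refine forall_congr' fun v => ?_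
  rw [fromRows_mulVec, ← Sum.elim_zero_zero, Sum.elim_eq_iff, and_imp, sub_mulVec, smul_mulVec,
    one_mulVec, sub_eq_zero]

theorem complexify_mul {l m n : Type*} [Fintype m] (M : Matrix l m ℝ) (N : Matrix m n ℝ) :
    complexify (M * N) = complexify M * complexify N :=
  Matrix.map_mul (f := Complex.ofRealHom)

theorem complexify_fromBlocks {l m n o : Type*} (A : Matrix n l ℝ) (B : Matrix n m ℝ)
    (C : Matrix o l ℝ) (D : Matrix o m ℝ) :
    complexify (fromBlocks A B C D) =
      fromBlocks (complexify A) (complexify B) (complexify C) (complexify D) :=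
  fromBlocks_map ..

theorem complexify_fromCols {l m n : Type*} (A : Matrix n l ℝ) (B : Matrix n m ℝ) :
    complexify (fromCols A B) = fromCols (complexify A) (complexify B) := by
  ext i (j | j) <;> rfl

/-- The augmented plant is detectable. -/
theorem isDetectable_augmented {n m p q : Type*} [Fintype n] [DecidableEq n]
    [Fintype m] [DecidableEq m] [Fintype q]
    (A : Matrix n n ℝ) (B : Matrix n q ℝ) (C : Matrix p n ℝ) (D : Matrix p q ℝ)
    (Am : Matrix m m ℝ) (Cm : Matrix q m ℝ)
    (hAC : IsDetectable A C) (hAmCm : IsDetectable Am Cm)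
    (hrank : RankConditionAtUnstableModes A B C D Am) :
    IsDetectable (augA A B Am Cm) (augC C D Cm) := by
  rw [isDetectable_iff] at *
  intro lam hlam ξ h1 h2
  obtain ⟨v, w, rfl⟩ : ∃ v w, ξ = Sum.elim v w := ⟨ξ ∘ Sum.inl, ξ ∘ Sum.inr, by simp⟩
  have hs : lam • Sum.elim v w = Sum.elim (lam • v) (lam • w) := by
    ext (i | i) <;> rfl
  have h0 : complexify (0 : Matrix m n ℝ) = 0 := by ext; simp [complexify]
  rw [augA, complexify_fromBlocks, fromBlocks_mulVec, Sum.elim_comp_inl, Sum.elim_comp_inr, hs,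
    Sum.elim_eq_iff, h0, complexify_mul, ← mulVec_mulVec, zero_mulVec, zero_add] at h1
  rw [augC, complexify_fromCols, fromCols_mulVec_sumElim, complexify_mul, ← mulVec_mulVec] at h2
  obtain ⟨h1, h3⟩ := h1
  -- Otherwise `lam` is an unstable eigenvalue of Am and (v, Cm w) lies in the kernel of the
  -- rank-condition matrix, so Cm w = 0, against detectability of (Am, Cm).
  have hw : w = 0 := by
    by_contra hw
    have hev : Module.End.HasEigenvalue (Matrix.toLin' (complexify Am)) lam :=
      Module.End.hasEigenvalue_of_hasEigenvector (x := w)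
        ⟨Module.End.mem_eigenspace_iff.2 (by simpa using h3), hw⟩
    have hr := (hasFullColumnRank_iff _).1 (hrank lam hev hlam)
      (Sum.elim v (complexify Cm *ᵥ w)) (by
        rw [fromBlocks_mulVec, Sum.elim_comp_inl, Sum.elim_comp_inr, h2, sub_mulVec,
          smul_mulVec, one_mulVec, sub_add_eq_add_sub, h1, sub_self, Sum.elim_zero_zero])
    rw [← Sum.elim_zero_zero, Sum.elim_eq_iff] at hr
    exact hw (hAmCm lam hlam w h3 hr.2)
  subst hw
  rw [mulVec_zero, mulVec_zero, add_zero] at h1 h2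
  rw [hAC lam hlam v h1 h2, Sum.elim_zero_zero]

/-! ### Semidefinite certificates of undetectability -/

/-- The trace is the sum of the complex eigenvalues; were all real parts negative, this nonempty sum
would have negative real part. -/
theorem exists_eigenvector_re_nonneg_of_trace_nonneg {ι : Type*} [Fintype ι] [DecidableEq ι]
    [Nonempty ι] (M : Matrix ι ι ℝ) (hM : 0 ≤ M.trace) :
    ∃ lam : ℂ, 0 ≤ lam.re ∧ ∃ w : ι → ℂ, w ≠ 0 ∧ complexify M *ᵥ w = lam • w := by
  have htr : (complexify M).trace = (M.trace : ℂ) := by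
    simp [Matrix.trace, complexify]
  have hsum := congrArg Complex.re
    (htr.symm.trans (Matrix.trace_eq_sum_roots_charpoly (complexify M)))
  rw [Complex.ofReal_re] at hsum
  obtain ⟨lam, hmem, hlam⟩ : ∃ lam ∈ (complexify M).charpoly.roots, 0 ≤ lam.re := by
    by_contra! hneg
    have hne : (complexify M).charpoly.roots ≠ 0 := by
      rw [← Multiset.card_pos, IsAlgClosed.card_roots_eq_natDegree, charpoly_natDegree_eq_dim]
      exact Fintype.card_pos
    have h2 : ((complexify M).charpoly.roots.map Complex.re).sum < 0 := by
      have := Multiset.sum_lt_sum_of_nonempty (f := Complex.re) (g := fun _ => (0 : ℝ)) hne hneg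
      simpa using this
    have h3 : (complexify M).charpoly.roots.sum.re =
        ((complexify M).charpoly.roots.map Complex.re).sum :=
      map_multiset_sum Complex.reAddGroupHom _
    linarith
  refine ⟨lam, hlam, ?_⟩
  have hroot := (Polynomial.mem_roots'.1 hmem).2
  rw [Polynomial.IsRoot, eval_charpoly] at hroot
  obtain ⟨w, hw, h⟩ := exists_mulVec_eq_zero_iff.2 hroot
  refine ⟨w, hw, ?_⟩
  rw [sub_mulVec, sub_eq_zero] at h
  rw [← h]
  ext i
  simp [scalar_apply, mulVec_diagonal]

/-- A positive semidefinite real matrix with a zero on the diagonal has a zero column there. -/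
theorem Matrix.PosSemidef.apply_eq_zero_of_diag_eq_zero {n : Type*} [Fintype n] [DecidableEq n]
    {G : Matrix n n ℝ} (hG : G.PosSemidef) {i : n} (hi : G i i = 0) (j : n) : G i j = 0 := by
  have hsymm : G j i = G i j := by simpa using hG.1.apply i j
  -- Since G i i = 0, the form at e_j + t e_i is affine in t; being nonnegative for all t, it has
  -- zero slope.
  have key : ∀ t : ℝ, 0 ≤ G j j + 2 * t * G i j := by
    intro t
    have h := hG.dotProduct_mulVec_nonneg (Pi.single j 1 + t • Pi.single i 1)
    simp only [star_trivial, mulVec_add, mulVec_smul, add_dotProduct, dotProduct_add,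
      smul_dotProduct, dotProduct_smul, mulVec_single_one, single_one_dotProduct, col_apply, hi,
      hsymm, smul_eq_mul] at h
    linarith
  by_contra hne
  have h := key (-(G j j + 1) / (2 * G i j))
  have : 2 * (-(G j j + 1) / (2 * G i j)) * G i j = -(G j j + 1) := by field_simp
  linarith

/-- A positive semidefinite certificate of undetectability. -/
theorem not_isDetectable_of_posSemidef {n p : Type*} [Fintype n] [DecidableEq n]
    {A Z : Matrix n n ℝ} {C : Matrix p n ℝ} (hZ : Z.PosSemidef) (hZ0 : Z ≠ 0) (hCZ : C * Z = 0)
    (hAZ : (A * Z + Z * Aᵀ).PosSemidef) : ¬ IsDetectable A C := by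
  intro hdet
  rw [isDetectable_iff] at hdet
  set d := hZ.1.eigenvalues with hd
  set U : Matrix n n ℝ := (hZ.1.eigenvectorUnitary : Matrix n n ℝ) with hU
  have hd0 : ∀ i, 0 ≤ d i := hZ.eigenvalues_nonneg
  have hUU : U * Uᵀ = 1 := by
    have := Unitary.coe_mul_star_self hZ.1.eigenvectorUnitary
    rwa [Unitary.coe_star, star_eq_conjTranspose, conjTranspose_eq_transpose_of_trivial] at this
  have hUU' : Uᵀ * U = 1 := by
    have := Unitary.coe_star_mul_self hZ.1.eigenvectorUnitary
    rwa [star_eq_conjTranspose, conjTranspose_eq_transpose_of_trivial] at this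
  have hspec : Z = U * diagonal d * Uᵀ := by
    have := hZ.1.spectral_theorem
    rw [Unitary.conjStarAlgAut_apply, star_eq_conjTranspose,
      conjTranspose_eq_transpose_of_trivial] at this
    exact this
  have hZU : Z * U = U * diagonal d := by
    rw [hspec, Matrix.mul_assoc, hUU', Matrix.mul_one]
  have hUZ : Uᵀ * Z = diagonal d * Uᵀ := by
    rw [hspec, ← Matrix.mul_assoc, ← Matrix.mul_assoc, hUU', Matrix.one_mul]
  -- In an eigenbasis of Z the hypothesis says that A'd + dA'ᵀ is positive semidefinite. Its
  -- diagonal gives A' j j ≥ 0 where d j > 0. Where d i = 0 its diagonal entry vanishes, hence so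
  -- does row i, which makes the span of the eigenvectors with d j > 0 invariant.
  set A' := Uᵀ * A * U with hA'
  have hG : (A' * diagonal d + diagonal d * A'ᵀ).PosSemidef := by
    have h := hAZ.conjTranspose_mul_mul_same U
    rw [conjTranspose_eq_transpose_of_trivial] at h
    convert h using 1
    rw [Matrix.mul_add, Matrix.add_mul, Matrix.mul_assoc Uᵀ (A * Z) U, Matrix.mul_assoc A Z U, hZU,
      ← Matrix.mul_assoc Uᵀ Z, hUZ, hA']
    simp only [transpose_mul, transpose_transpose, Matrix.mul_assoc]
  have hGapp : ∀ i j, (A' * diagonal d + diagonal d * A'ᵀ) i j = A' i j * d j + d i * A' j i := by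
    intro i j
    simp [mul_diagonal, diagonal_mul]
  have hdiag : ∀ j, 0 < d j → 0 ≤ A' j j := by
    intro j hj
    have h := hG.diag_nonneg (i := j)
    rw [hGapp] at h
    nlinarith
  have hoff : ∀ i j, d i = 0 → 0 < d j → A' i j = 0 := by
    intro i j hi hj
    have h := hG.apply_eq_zero_of_diag_eq_zero (i := i) (by rw [hGapp, hi]; ring) j
    rw [hGapp, hi, zero_mul, add_zero] at h
    exact (mul_eq_zero.1 h).resolve_right hj.ne'
  have hCU : ∀ i j, 0 < d j → (C * U) i j = 0 := by
    intro i j hj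
    have h : C * U * diagonal d = 0 := by
      rw [Matrix.mul_assoc, ← hZU, ← Matrix.mul_assoc, hCZ, Matrix.zero_mul]
    have h2 := congrFun (congrFun h i) j
    rw [mul_diagonal] at h2
    exact (mul_eq_zero.1 h2).resolve_right hj.ne'
  obtain ⟨j₀, hj₀⟩ : ∃ j, 0 < d j := by
    by_contra! hneg
    apply hZ0
    have : d = 0 := funext fun i => le_antisymm (hneg i) (hd0 i)
    rw [hspec, this]
    simp
  let J := {j // 0 < d j}
  have : Nonempty J := ⟨⟨j₀, hj₀⟩⟩
  obtain ⟨lam, hlam, w, hw0, hw⟩ := exists_eigenvector_re_nonneg_of_trace_nonneg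
    (A'.submatrix ((↑) : J → n) (↑)) (Finset.sum_nonneg fun j _ => hdiag j j.2)
  -- Extension by zero of an eigenvector of the block on J; by `hoff` it remains an eigenvector of
  -- all of A'.
  let w' : n → ℂ := fun i => if h : 0 < d i then w ⟨i, h⟩ else 0
  have hw'J : ∀ j : J, w' j = w j := fun j => dif_pos j.2
  have hw'0 : ∀ j, ¬ 0 < d j → w' j = 0 := fun j hj => dif_neg hj
  have hmul : ∀ f : n → ℂ, ∑ j, f j * w' j = ∑ j : J, f j * w j := by
    intro f
    rw [← Fintype.sum_subtype_add_sum_subtype (fun j => 0 < d j) (fun j => f j * w' j),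
      Fintype.sum_eq_zero (fun j : {j // ¬ 0 < d j} => f j * w' j)
        (fun j => by rw [hw'0 j j.2, mul_zero]), add_zero]
    exact Finset.sum_congr rfl fun j _ => by rw [hw'J]
  have hAw' : complexify A' *ᵥ w' = lam • w' := by
    ext i
    rw [mulVec, dotProduct, hmul]
    by_cases hi : 0 < d i
    · have h := congrFun hw ⟨i, hi⟩
      rw [Pi.smul_apply, ← hw'J] at h
      exact h
    · rw [Pi.smul_apply, hw'0 i hi, smul_zero]
      refine Finset.sum_eq_zero fun j _ => ?_
      simp [complexify, hoff i j (le_antisymm (not_lt.1 hi) (hd0 i)) j.2]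
  have hUA : U * A' = A * U := by
    rw [hA', ← Matrix.mul_assoc, ← Matrix.mul_assoc, hUU, Matrix.one_mul]
  have hv := hdet lam hlam (complexify U *ᵥ w')
    (by rw [mulVec_mulVec, ← complexify_mul, ← hUA, complexify_mul, ← mulVec_mulVec, hAw',
      mulVec_smul])
    (by
      rw [mulVec_mulVec, ← complexify_mul]
      ext i
      rw [mulVec, dotProduct, hmul]
      refine Finset.sum_eq_zero fun j _ => ?_
      simp [complexify, hCU i j j.2])
  have hw'z : w' = 0 := by
    have h1 : complexify (1 : Matrix n n ℝ) = 1 := Matrix.map_one _ (by simp) (by simp)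
    have h := congrArg (fun x => complexify Uᵀ *ᵥ x) hv
    simpa only [mulVec_mulVec, ← complexify_mul, hUU', h1, one_mulVec, mulVec_zero] using h
  exact hw0 (funext fun j => by rw [← hw'J, hw'z]; rfl)

/-! ### Trace duality and the Lyapunov inequality as a convex feasibility problem -/

theorem exists_trace_mul_eq {n : Type*} [Fintype n] [DecidableEq n]
    (g : Matrix n n ℝ →ₗ[ℝ] ℝ) : ∃ W : Matrix n n ℝ, ∀ M, g M = (W * M).trace := by
  refine ⟨of fun j i => g (single i j 1), fun M => ?_⟩
  conv_lhs => rw [matrix_eq_sum_single M]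
  simp only [map_sum, Matrix.trace, diag_apply, mul_apply, of_apply]
  rw [Finset.sum_comm]
  refine Finset.sum_congr rfl fun j _ => Finset.sum_congr rfl fun i _ => ?_
  have : single i j (M i j) = M i j • single i j (1 : ℝ) := by simp
  rw [this, map_smul, smul_eq_mul, mul_comm]

theorem dotProduct_mulVec_smul_smul {n : Type*} [Fintype n] (M : Matrix n n ℝ) (r : ℝ)
    (x : n → ℝ) : (r • x) ⬝ᵥ M *ᵥ (r • x) = r ^ 2 * (x ⬝ᵥ M *ᵥ x) := by
  rw [mulVec_smul, dotProduct_smul, smul_dotProduct, smul_eq_mul, smul_eq_mul]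
  ring

theorem trace_mul_vecMulVec_self {n : Type*} [Fintype n] (W : Matrix n n ℝ) (x : n → ℝ) :
    (W * vecMulVec x x).trace = x ⬝ᵥ W *ᵥ x := by
  rw [mul_vecMulVec, trace_vecMulVec, dotProduct_comm]

/-- The matrices whose quadratic form is positive definite form an open set. -/
theorem isOpen_setOf_quadratic_pos (n : Type*) [Fintype n] :
    IsOpen {M : Matrix n n ℝ | ∀ x, x ≠ 0 → 0 < x ⬝ᵥ M *ᵥ x} := by
  -- By homogeneity positivity need only be tested on the unit sphere, whose compactness makes it
  -- stable under perturbation of M.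
  have hset : {M : Matrix n n ℝ | ∀ x, x ≠ 0 → 0 < x ⬝ᵥ M *ᵥ x} =
      {M | ∀ x ∈ Metric.sphere (0 : n → ℝ) 1, 0 < x ⬝ᵥ M *ᵥ x} := by
    ext M
    refine ⟨fun h x hx => h x (ne_zero_of_mem_unit_sphere ⟨x, hx⟩), fun h x hx => ?_⟩
    have hn : 0 < ‖x‖ := norm_pos_iff.2 hx
    have h1 := h (‖x‖⁻¹ • x) (by
      rw [mem_sphere_zero_iff_norm, norm_smul, norm_inv, norm_norm, inv_mul_cancel₀ hn.ne'])
    rw [dotProduct_mulVec_smul_smul] at h1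
    exact pos_of_mul_pos_right h1 (by positivity)
  rw [hset, isOpen_iff_mem_nhds]
  intro M hM
  refine (isCompact_sphere (0 : n → ℝ) 1).eventually_forall_of_forall_eventually fun x hx => ?_
  have hc : Continuous fun q : Matrix n n ℝ × (n → ℝ) => q.2 ⬝ᵥ q.1 *ᵥ q.2 := by fun_prop
  exact hc.continuousAt.eventually (lt_mem_nhds (hM x hx))

/-- Self-duality of the semidefinite cone, tested on matrices that need not be symmetric. A skew K
has zero quadratic form, so both K and -K are admissible and tr(WK) = 0, which forces W symmetric;
the rank-one matrices x xᵀ then give the form of W. -/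
theorem posSemidef_of_trace_mul_nonneg {n : Type*} [Fintype n] [DecidableEq n]
    (W : Matrix n n ℝ)
    (h : ∀ M : Matrix n n ℝ, (∀ x, 0 ≤ x ⬝ᵥ M *ᵥ x) → 0 ≤ (W * M).trace) : W.PosSemidef := by
  refine PosSemidef.of_dotProduct_mulVec_nonneg ?_ fun x => ?_
  · have hsk : ∀ K : Matrix n n ℝ, Kᵀ = -K → (W * K).trace = 0 := by
      intro K hK
      have hq : ∀ x, x ⬝ᵥ K *ᵥ x = 0 := by
        intro x
        have h1 : x ⬝ᵥ Kᵀ *ᵥ x = x ⬝ᵥ K *ᵥ x := by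
          rw [mulVec_transpose, dotProduct_comm, dotProduct_mulVec]
        rw [hK, neg_mulVec, dotProduct_neg] at h1
        linarith
      have h1 := h K fun x => (hq x).ge
      have h2 := h (-K) fun x => by rw [neg_mulVec, dotProduct_neg, hq, neg_zero]
      rw [Matrix.mul_neg, trace_neg] at h2
      linarith
    ext i j
    have h1 := hsk (single i j 1 - single j i 1) (by simp [transpose_sub])
    rw [Matrix.mul_sub, trace_sub, trace_mul_single, trace_mul_single] at h1
    simp only [conjTranspose_apply, star_trivial]
    simpa [sub_eq_zero] using h1
  · rw [star_trivial, ← trace_mul_vecMulVec_self]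
    refine h _ fun y => ?_
    rw [vecMulVec_mulVec, dotProduct_smul, dotProduct_comm y x]
    exact mul_self_nonneg _

/-- A functional bounded below on a subspace vanishes there, so the separating level is at most 0.
-/
theorem exists_dual_neg_of_disjoint_submodule {E : Type*} [TopologicalSpace E] [AddCommGroup E]
    [Module ℝ E] [IsTopologicalAddGroup E] [ContinuousSMul ℝ E] {s : Set E} (hs : Convex ℝ s)
    (ho : IsOpen s) (V : Submodule ℝ E) (hd : Disjoint s V) :
    ∃ f : StrongDual ℝ E, (∀ a ∈ s, f a < 0) ∧ ∀ b ∈ V, f b = 0 := by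
  obtain ⟨f, u, hf1, hf2⟩ := geometric_hahn_banach_open hs ho V.convex hd
  have hu : u ≤ 0 := by simpa using hf2 0 (zero_mem V)
  refine ⟨f, fun a ha => (hf1 a ha).trans_le hu, fun b hb => ?_⟩
  by_contra hne
  -- The multiple of b at which f equals u - 1, below the separating level.
  have h1 := hf2 _ (V.smul_mem ((u - 1) / f b) hb)
  rw [map_smul, smul_eq_mul, div_mul_cancel₀ _ hne] at h1
  linarith

/-- Detectable pairs admit an output injection with a quadratic Lyapunov function. -/
theorem IsDetectable.exists_lyapunov {n p : Type*} [Fintype n] [DecidableEq n] [Fintype p]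
    {A : Matrix n n ℝ} {C : Matrix p n ℝ} (h : IsDetectable A C) :
    ∃ (P : Matrix n n ℝ) (L : Matrix n p ℝ), P.PosDef ∧
      ∀ x, x ≠ 0 → x ⬝ᵥ (P * (A + L * C)) *ᵥ x < 0 := by
  classical
  set O₁ := {M : Matrix n n ℝ | ∀ x, x ≠ 0 → 0 < x ⬝ᵥ M *ᵥ x} with hO₁
  have hconv : Convex ℝ O₁ := by
    intro M hM N hN a b ha hb hab x hx
    have hM := hM x hx
    have hN := hN x hx
    rw [add_mulVec, smul_mulVec, smul_mulVec, dotProduct_add, dotProduct_smul, dotProduct_smul,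
      smul_eq_mul, smul_eq_mul]
    rcases ha.eq_or_lt with rfl | ha
    · rw [zero_add] at hab
      subst hab
      linarith
    · have := mul_pos ha hM
      have := mul_nonneg hb hN.le
      linarith
  -- P is parametrised as S + Sᵀ with S arbitrary, so that no symmetry constraint is needed and O₁
  -- is open in the full matrix space. With Y = PL, a solution exists as soon as the range of φ
  -- meets O₁ ×ˢ O₁.
  let φ : Matrix n n ℝ × Matrix n p ℝ →ₗ[ℝ] Matrix n n ℝ × Matrix n n ℝ :=
    { toFun := fun q => (q.1, -((q.1 + q.1ᵀ) * A + q.2 * C))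
      map_add' := fun q r => by
        ext : 1
        · rfl
        · simp only [Prod.fst_add, Prod.snd_add, transpose_add, Matrix.add_mul]
          abel
      map_smul' := fun c q => by
        ext : 1
        · rfl
        · simp only [Prod.smul_fst, Prod.smul_snd, transpose_smul, Matrix.add_mul,
            Matrix.smul_mul, RingHom.id_apply, smul_neg, smul_add] }
  by_cases hdisj : Disjoint (O₁ ×ˢ O₁) (LinearMap.range φ : Set _)
  · exfalso
    have hc : Convex ℝ (O₁ ×ˢ O₁) := hconv.prod hconv
    have ho : IsOpen (O₁ ×ˢ O₁) := (isOpen_setOf_quadratic_pos n).prod (isOpen_setOf_quadratic_pos n)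
    obtain ⟨f, hf1, hf2⟩ := exists_dual_neg_of_disjoint_submodule hc ho (LinearMap.range φ) hdisj
    have hfφ : ∀ q, f (φ q) = 0 := fun q => hf2 _ ⟨q, rfl⟩
    obtain ⟨W, hW⟩ := exists_trace_mul_eq
      (-((f : Matrix n n ℝ × Matrix n n ℝ →ₗ[ℝ] ℝ) ∘ₗ LinearMap.inl ℝ _ _))
    obtain ⟨Z, hZ⟩ := exists_trace_mul_eq
      (-((f : Matrix n n ℝ × Matrix n n ℝ →ₗ[ℝ] ℝ) ∘ₗ LinearMap.inr ℝ _ _))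
    have hWZ : ∀ M N, (W * M).trace + (Z * N).trace = - f (M, N) := by
      intro M N
      have : (M, N) = (M, 0) + (0, N) := by simp
      rw [← hW, ← hZ, this, map_add]
      simp
      abel
    have hpos : ∀ M ∈ O₁, ∀ N ∈ O₁, 0 < (W * M).trace + (Z * N).trace := by
      intro M hM N hN
      rw [hWZ]
      have := hf1 (M, N) ⟨hM, hN⟩
      linarith
    -- Adding ε times the identity moves the closed cone into O₁; letting ε tend to 0 turns `hpos`
    -- into the weak inequality `hnn`.
    have hone : ∀ M : Matrix n n ℝ, (∀ x, 0 ≤ x ⬝ᵥ M *ᵥ x) → ∀ ε : ℝ, 0 < ε →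
        M + ε • (1 : Matrix n n ℝ) ∈ O₁ := by
      intro M hM ε hε x hx
      rw [add_mulVec, smul_mulVec, one_mulVec, dotProduct_add, dotProduct_smul, smul_eq_mul]
      have h1 : 0 < x ⬝ᵥ x := by simpa using dotProduct_star_self_pos_iff.2 hx
      have := hM x
      positivity
    have hnn : ∀ M N : Matrix n n ℝ, (∀ x, 0 ≤ x ⬝ᵥ M *ᵥ x) → (∀ x, 0 ≤ x ⬝ᵥ N *ᵥ x) →
        0 ≤ (W * M).trace + (Z * N).trace := by
      intro M N hM hN
      refine le_of_forall_pos_lt_add fun δ hδ => ?_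
      have hk : 0 < |W.trace + Z.trace| + 1 := by positivity
      have h1 := hpos _ (hone M hM (δ / (|W.trace + Z.trace| + 1)) (by positivity)) _
        (hone N hN (δ / (|W.trace + Z.trace| + 1)) (by positivity))
      simp only [Matrix.mul_add, trace_add, Matrix.mul_smul, Matrix.mul_one, trace_smul,
        smul_eq_mul] at h1
      have h2 : δ / (|W.trace + Z.trace| + 1) * (W.trace + Z.trace) ≤ δ := by
        rw [div_mul_eq_mul_div, div_le_iff₀ hk]
        exact mul_le_mul_of_nonneg_left (by linarith [le_abs_self (W.trace + Z.trace)]) hδ.le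
      linarith
    have hWpsd : W.PosSemidef := posSemidef_of_trace_mul_nonneg W fun M hM => by
      simpa using hnn M 0 hM (by simp)
    have hZpsd : Z.PosSemidef := posSemidef_of_trace_mul_nonneg Z fun M hM => by
      simpa using hnn 0 M (by simp) hM
    have hZT : Zᵀ = Z := by
      simpa [conjTranspose_eq_transpose_of_trivial] using hZpsd.1.eq
    -- The functional vanishes on the range of φ: varying Y alone gives CZ = 0, and varying S alone
    -- gives W = AZ + ZAᵀ.
    have hCZ : C * Z = 0 := by
      rw [ext_iff_trace_mul_right]
      intro Y
      have h1 := hWZ 0 (-(Y * C))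
      have h2 := hfφ (0, Y)
      have h3 : φ (0, Y) = (0, -(Y * C)) := by simp [φ]
      rw [h3] at h2
      rw [h2] at h1
      simp only [Matrix.mul_zero, trace_zero, Matrix.mul_neg, trace_neg] at h1
      rw [Matrix.zero_mul, trace_zero, Matrix.mul_assoc, trace_mul_comm, Matrix.mul_assoc]
      linarith
    have hWeq : W = A * Z + Z * Aᵀ := by
      rw [ext_iff_trace_mul_right]
      intro S
      have h1 := hWZ S (-((S + Sᵀ) * A))
      have h2 := hfφ (S, 0)
      have h3 : φ (S, 0) = (S, -((S + Sᵀ) * A)) := by simp [φ]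
      rw [h3] at h2
      rw [h2] at h1
      have h4 : (Z * (Sᵀ * A)).trace = (Z * Aᵀ * S).trace := by
        rw [← trace_transpose, transpose_mul, transpose_mul, transpose_transpose, hZT,
          trace_mul_comm, Matrix.mul_assoc]
      have h5 : (Z * (S * A)).trace = (A * Z * S).trace := by
        rw [← Matrix.mul_assoc, trace_mul_comm, Matrix.mul_assoc]
      simp only [Matrix.mul_neg, trace_neg, Matrix.add_mul, Matrix.mul_add, trace_add, h4, h5]
        at h1
      rw [Matrix.add_mul, trace_add]
      linarith
    -- Z = 0 would force W = 0, against strict separation at the pair (1, 1).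
    have hZ0 : Z ≠ 0 := by
      rintro rfl
      have h1 := hpos (0 + (1 : ℝ) • 1) (hone 0 (by simp) 1 one_pos) (0 + (1 : ℝ) • 1)
        (hone 0 (by simp) 1 one_pos)
      simp [hWeq] at h1
    exact not_isDetectable_of_posSemidef hZpsd hZ0 hCZ (hWeq ▸ hWpsd) h
  · rw [Set.not_disjoint_iff] at hdisj
    obtain ⟨_, ⟨hS, hY⟩, ⟨⟨S, Y⟩, rfl⟩⟩ := hdisj
    replace hS : ∀ x, x ≠ 0 → 0 < x ⬝ᵥ S *ᵥ x := hS
    replace hY : ∀ x, x ≠ 0 → 0 < x ⬝ᵥ (-((S + Sᵀ) * A + Y * C)) *ᵥ x := hY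
    have hP : (S + Sᵀ).PosDef := by
      refine PosDef.of_dotProduct_mulVec_pos ?_ fun x hx => ?_
      · rw [IsHermitian, conjTranspose_eq_transpose_of_trivial, transpose_add,
          transpose_transpose, add_comm]
      · have h1 : x ⬝ᵥ Sᵀ *ᵥ x = x ⬝ᵥ S *ᵥ x := by
          rw [mulVec_transpose, dotProduct_comm, dotProduct_mulVec]
        rw [star_trivial, add_mulVec, dotProduct_add, h1]
        linarith [hS x hx]
    refine ⟨S + Sᵀ, (S + Sᵀ)⁻¹ * Y, hP, fun x hx => ?_⟩
    have h1 := hY x hx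
    rw [neg_mulVec, dotProduct_neg] at h1
    rw [Matrix.mul_add, ← Matrix.mul_assoc, ← Matrix.mul_assoc,
      mul_nonsing_inv _ ((isUnit_iff_isUnit_det _).1 hP.isUnit), Matrix.one_mul]
    linarith

end LinearAlgebra

section Stability

open Filter Topology Set

/-! ## Lyapunov functions and `L₂`-stability of linear systems -/

/-! ### Product rules for Carathéodory solutions -/

section ProductRule

variable {t₀ t : ℝ}

/-- Product rule for indefinite integrals of integrable real functions. -/
theorem intervalIntegral_mul_add_mul {f g x y : ℝ → ℝ} (ht : t₀ ≤ t)
    (hf : IntervalIntegrable f volume t₀ t) (hg : IntervalIntegrable g volume t₀ t)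
    (hx : ∀ s ∈ Icc t₀ t, x s = x t₀ + ∫ r in t₀..s, f r)
    (hy : ∀ s ∈ Icc t₀ t, y s = y t₀ + ∫ r in t₀..s, g r) :
    IntervalIntegrable (fun s => f s * y s + x s * g s) volume t₀ t ∧
      ∫ s in t₀..t, (f s * y s + x s * g s) = x t * y t - x t₀ * y t₀ := by
  -- Integration by parts is applied to the globally defined primitives, which are absolutely
  -- continuous with derivative the integrand almost everywhere; x and y are only known on the
  -- interval.
  have hac : ∀ {h : ℝ → ℝ} (c : ℝ), IntervalIntegrable h volume t₀ t →
      AbsolutelyContinuousOnInterval (fun s => (∫ r in t₀..s, h r) + c) t₀ t := by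
    intro h c hh
    refine AbsolutelyContinuousOnInterval.add
      (hh.absolutelyContinuousOnInterval_intervalIntegral left_mem_uIcc) ?_
    exact (LipschitzOnWith.of_dist_le_mul (K := 0) fun a _ b _ => by
      simp).absolutelyContinuousOnInterval
  have hX := hac (x t₀) hf
  have hY := hac (y t₀) hg
  have hderiv : ∀ {h : ℝ → ℝ} (c : ℝ), IntervalIntegrable h volume t₀ t →
      ∀ᵐ s, s ∈ uIcc t₀ t → deriv (fun s => (∫ r in t₀..s, h r) + c) s = h s := by
    intro h c hh
    filter_upwards [hh.ae_hasDerivAt_integral] with s hs hmem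
    exact ((hs hmem t₀ left_mem_uIcc).add_const c).deriv
  have hxX : ∀ s ∈ uIcc t₀ t, (∫ r in t₀..s, f r) + x t₀ = x s := fun s hs => by
    rw [hx s (uIcc_of_le ht ▸ hs), add_comm]
  have hyY : ∀ s ∈ uIcc t₀ t, (∫ r in t₀..s, g r) + y t₀ = y s := fun s hs => by
    rw [hy s (uIcc_of_le ht ▸ hs), add_comm]
  have hxc : ContinuousOn x (uIcc t₀ t) := hX.continuousOn.congr fun s hs => (hxX s hs).symm
  have hyc : ContinuousOn y (uIcc t₀ t) := hY.continuousOn.congr fun s hs => (hyY s hs).symm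
  refine ⟨(hf.mul_continuousOn hyc).add (hg.continuousOn_mul hxc), ?_⟩
  have h := hX.integral_deriv_mul_eq_sub hY
  rw [hxX t right_mem_uIcc, hyY t right_mem_uIcc, hxX t₀ left_mem_uIcc,
    hyY t₀ left_mem_uIcc] at h
  rw [← h]
  refine intervalIntegral.integral_congr_ae ?_
  filter_upwards [hderiv (x t₀) hf, hderiv (y t₀) hg] with s h1 h2 hs
  have hs' := uIoc_subset_uIcc hs
  rw [h1 hs', h2 hs', hxX s hs', hyY s hs']

/-- Product rule for the inner product of two indefinite integrals. -/
theorem intervalIntegral_inner_add_inner {E : Type*} [NormedAddCommGroup E]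
    [InnerProductSpace ℝ E] [FiniteDimensional ℝ E] {f g x y : ℝ → E} (ht : t₀ ≤ t)
    (hf : IntervalIntegrable f volume t₀ t) (hg : IntervalIntegrable g volume t₀ t)
    (hx : ∀ s ∈ Icc t₀ t, x s = x t₀ + ∫ r in t₀..s, f r)
    (hy : ∀ s ∈ Icc t₀ t, y s = y t₀ + ∫ r in t₀..s, g r) :
    IntervalIntegrable (fun s => inner ℝ (f s) (y s) + inner ℝ (x s) (g s)) volume t₀ t ∧
      ∫ s in t₀..t, (inner ℝ (f s) (y s) + inner ℝ (x s) (g s)) =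
        inner ℝ (x t) (y t) - inner ℝ (x t₀) (y t₀) := by
  let b := stdOrthonormalBasis ℝ E
  have hb : ∀ u v : E, inner ℝ u v = ∑ i, inner ℝ (b i) u * inner ℝ (b i) v := fun u v => by
    rw [← b.sum_inner_mul_inner]
    exact Finset.sum_congr rfl fun i _ => by rw [real_inner_comm]
  have hci : ∀ i {h : ℝ → E}, IntervalIntegrable h volume t₀ t →
      IntervalIntegrable (fun s => inner ℝ (b i) (h s)) volume t₀ t := fun i h hh =>
    ⟨(innerSL ℝ (b i)).integrable_comp hh.1, (innerSL ℝ (b i)).integrable_comp hh.2⟩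
  have hcoord : ∀ i {h z : ℝ → E}, IntervalIntegrable h volume t₀ t →
      (∀ s ∈ Icc t₀ t, z s = z t₀ + ∫ r in t₀..s, h r) →
      ∀ s ∈ Icc t₀ t, inner ℝ (b i) (z s) =
        inner ℝ (b i) (z t₀) + ∫ r in t₀..s, inner ℝ (b i) (h r) := by
    intro i h z hh hz s hs
    have hhs : IntervalIntegrable h volume t₀ s := hh.mono_set (by
      rw [uIcc_of_le hs.1, uIcc_of_le ht]
      exact Icc_subset_Icc_right hs.2)
    have h1 := (innerSL ℝ (b i)).intervalIntegral_comp_comm hhs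
    simp only [innerSL_apply_apply] at h1
    rw [h1, hz s hs, inner_add_right]
  have key := fun i => intervalIntegral_mul_add_mul ht (hci i hf) (hci i hg)
    (hcoord i hf hx) (hcoord i hg hy)
  have hsum : (fun s => inner ℝ (f s) (y s) + inner ℝ (x s) (g s)) = fun s =>
      ∑ i, (inner ℝ (b i) (f s) * inner ℝ (b i) (y s) +
        inner ℝ (b i) (x s) * inner ℝ (b i) (g s)) := by
    funext s
    rw [hb, hb (x s), Finset.sum_add_distrib]
  rw [hsum]
  refine ⟨?_, ?_⟩
  · simpa only [Finset.sum_fn] using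
      IntervalIntegrable.sum Finset.univ fun i _ => (key i).1
  · rw [intervalIntegral.integral_finsetSum fun i _ => (key i).1, hb (x t), hb (x t₀),
      ← Finset.sum_sub_distrib]
    exact Finset.sum_congr rfl fun i _ => (key i).2

end ProductRule

/-! ### Energies of signals -/

section Signals

variable {V : Type*} [NormedAddCommGroup V] {t₀ : ℝ} {v : ℝ → V}

theorem IsL2Signal.integrableOn_sq (hv : IsL2Signal t₀ v) :
    IntegrableOn (fun s => ‖v s‖ ^ 2) (Ici t₀) :=
  hv.integrable_norm_pow two_ne_zero

theorem sq_l2Norm (t₀ : ℝ) (v : ℝ → V) : l2Norm t₀ v ^ 2 = ∫ s in Ici t₀, ‖v s‖ ^ 2 :=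
  Real.sq_sqrt (integral_nonneg fun _ => by positivity)

theorem IsL2Signal.intervalIntegrable_sq (hv : IsL2Signal t₀ v) {t : ℝ} (ht : t₀ ≤ t) :
    IntervalIntegrable (fun s => ‖v s‖ ^ 2) volume t₀ t := by
  rw [intervalIntegrable_iff_integrableOn_Ioc_of_le ht]
  exact hv.integrableOn_sq.mono_set fun s hs => hs.1.le

theorem IsL2Signal.intervalIntegral_sq_le (hv : IsL2Signal t₀ v) {t : ℝ} (ht : t₀ ≤ t) :
    ∫ s in t₀..t, ‖v s‖ ^ 2 ≤ l2Norm t₀ v ^ 2 := by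
  rw [sq_l2Norm, intervalIntegral.integral_of_le ht]
  exact setIntegral_mono_set hv.integrableOn_sq (ae_of_all _ fun _ => by positivity)
    (Eventually.of_forall fun s hs => le_of_lt hs.1)

/-- A continuous signal whose truncated energies are bounded is `L₂`. -/
theorem isL2Signal_of_intervalIntegral_sq_le (hv : ContinuousOn v (Ici t₀)) {K : ℝ}
    (hK : ∀ t, t₀ ≤ t → ∫ s in t₀..t, ‖v s‖ ^ 2 ≤ K) :
    IsL2Signal t₀ v ∧ l2Norm t₀ v ^ 2 ≤ K := by
  have hint : IntegrableOn (fun s => ‖v s‖ ^ 2) (Ioi t₀) := by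
    refine integrableOn_Ioi_of_intervalIntegral_norm_bounded K t₀ (fun i => ?_) tendsto_id
      ((eventually_ge_atTop t₀).mono fun t ht => ?_)
    · have hc : ContinuousOn (fun s => ‖v s‖ ^ 2) (Icc t₀ i) :=
        (hv.mono Icc_subset_Ici_self).norm.pow 2
      exact hc.integrableOn_Icc.mono_set Ioc_subset_Icc_self
    · simpa using hK t ht
  refine ⟨(memLp_two_iff_integrable_sq_norm
    (hv.aestronglyMeasurable measurableSet_Ici)).2
      ((integrableOn_Ici_iff_integrableOn_Ioi (by finiteness)).2 hint), ?_⟩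
  rw [sq_l2Norm, integral_Ici_eq_integral_Ioi]
  exact le_of_tendsto (intervalIntegral_tendsto_integral_Ioi t₀ hint tendsto_id)
    ((eventually_ge_atTop t₀).mono fun t ht => hK t ht)

end Signals

/-- A linear image of an `L₂` signal, extended by zero, is locally integrable. -/
theorem intervalIntegrable_indicator_comp {E V : Type*} [NormedAddCommGroup E]
    [NormedSpace ℝ E] [NormedAddCommGroup V] [NormedSpace ℝ V] {t₀ : ℝ} {v : ℝ → V} (N : V →L[ℝ] E)
    (hv : IsL2Signal t₀ v) (a b : ℝ) :
    IntervalIntegrable ((Ici t₀).indicator fun s => N (v s)) volume a b := by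
  have h1 : MemLp ((Ici t₀).indicator fun s => N (v s)) 2 volume :=
    (memLp_indicator_iff_restrict measurableSet_Ici).2 (N.comp_memLp' hv)
  exact intervalIntegrable_iff.2 (((h1.locallyIntegrable (by norm_num)).integrableOn_isCompact
    isCompact_uIcc).mono_set uIoc_subset_uIcc)

/-! ### Existence of solutions, energy estimates and stability -/

section LinearSystems

variable {E V Z : Type*} [NormedAddCommGroup E] [InnerProductSpace ℝ E] [FiniteDimensional ℝ E]
  [NormedAddCommGroup V] [NormedSpace ℝ V] [NormedAddCommGroup Z] [NormedSpace ℝ Z]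
  {t₀ : ℝ} {v : ℝ → V} {e : ℝ → E}

/-- Variation of constants for a continuous forcing term. -/
theorem exists_hasDerivAt_linear (M : E →L[ℝ] E) (t₀ : ℝ) (e₀ : E) {h : ℝ → E}
    (hh : Continuous h) : ∃ q : ℝ → E, q t₀ = e₀ ∧ ∀ t, HasDerivAt q (M (q t) + h t) t := by
  let _ := NormedAlgebra.restrictScalars ℚ ℝ (E →L[ℝ] E)
  let S : ℝ → E →L[ℝ] E := fun t => NormedSpace.exp (t • M)
  have hS : ∀ t, HasDerivAt S (M * S t) t := fun t => hasDerivAt_exp_smul_const' M t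
  have hSc : Continuous S := continuous_iff_continuousAt.2 fun t => (hS t).continuousAt
  have hinv : ∀ t, S t * S (-t) = 1 := by
    intro t
    have hcomm : Commute (t • M) ((-t) • M) := ((Commute.refl M).smul_left t).smul_right (-t)
    rw [← NormedSpace.exp_add_of_commute hcomm, ← add_smul, add_neg_cancel, zero_smul,
      NormedSpace.exp_zero]
  let k : ℝ → E := fun s => S (-(s - t₀)) (h s)
  have hk : Continuous k := (hSc.comp (by fun_prop)).clm_apply hh
  refine ⟨fun t => S (t - t₀) (e₀ + ∫ s in t₀..t, k s), ?_, fun t => ?_⟩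
  · simp [S]
  · have h1 : HasDerivAt (fun t => S (t - t₀)) (M * S (t - t₀)) t := by
      simpa using (hS (t - t₀)).comp_sub_const t t₀
    have h2 : HasDerivAt (fun t => e₀ + ∫ s in t₀..t, k s) (k t) t :=
      (hk.integral_hasStrictDerivAt t₀ t).hasDerivAt.const_add e₀
    have h3 := h1.clm_apply h2
    have h4 : S (t - t₀) (k t) = h t := congrArg (fun T : E →L[ℝ] E => T (h t)) (hinv (t - t₀))
    rw [h4] at h3
    exact h3

/-- The input is only L₂, so its primitive w is split off: q = e + w satisfies q' = Mq - Mw, whose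
forcing is continuous. -/
theorem exists_isSolution_linear (M : E →L[ℝ] E) (N : V →L[ℝ] E) (t₀ : ℝ) (e₀ : E)
    (hv : IsL2Signal t₀ v) :
    ∃ e : ℝ → E, IsSolution (fun _ e v => M e - N v) t₀ v e ∧ e t₀ = e₀ := by
  set u : ℝ → E := (Ici t₀).indicator fun s => N (v s) with hu
  have huint := intervalIntegrable_indicator_comp N hv
  let w : ℝ → E := fun t => ∫ s in t₀..t, u s
  have hw : Continuous w := intervalIntegral.continuous_primitive huint t₀
  obtain ⟨q, hq0, hq⟩ := exists_hasDerivAt_linear M t₀ e₀ (h := fun t => -M (w t)) (by fun_prop)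
  have hqc : Continuous q := continuous_iff_continuousAt.2 fun t => (hq t).continuousAt
  have hec : Continuous fun t => q t - w t := hqc.sub hw
  have hMint : ∀ t, IntervalIntegrable (fun s => M (q s - w s)) volume t₀ t := fun t =>
    (M.continuous.comp hec).intervalIntegrable _ _
  have hcongr : ∀ t, t₀ ≤ t → ∀ s ∈ uIoc t₀ t, M (q s - w s) - u s = M (q s - w s) - N (v s) := by
    intro t ht s hs
    rw [uIoc_of_le ht] at hs
    rw [hu, indicator_of_mem (show s ∈ Ici t₀ from hs.1.le)]
  have he0 : q t₀ - w t₀ = e₀ := by simp [w, hq0]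
  refine ⟨fun t => q t - w t, ⟨hec.continuousOn, fun t ht => ?_, fun t ht => ?_⟩, he0⟩
  · exact ((hMint t).sub (huint t₀ t)).congr (hcongr t ht)
  · have h1 : ∫ s in t₀..t, M (q s - w s) = q t - q t₀ :=
      intervalIntegral.integral_eq_sub_of_hasDerivAt
        (fun s _ => by simpa [sub_eq_add_neg] using hq s) (hMint t)
    rw [he0, ← intervalIntegral.integral_congr_ae (ae_of_all _ (hcongr t ht)),
      intervalIntegral.integral_sub (hMint t) (huint t₀ t), h1, hq0]
    simp only [w]
    abel

variable {M P : E →L[ℝ] E} {N : V →L[ℝ] E} {a b : ℝ}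

/-- Energy inequality along the solutions of a linear system with a quadratic Lyapunov function. -/
theorem IsSolution.energy_le (hP : ∀ x y, inner ℝ (P x) y = inner ℝ x (P y)) (ha : 0 < a)
    (hM : ∀ x, inner ℝ (P x) (M x) ≤ -a * ‖x‖ ^ 2)
    (hv : IsL2Signal t₀ v) (he : IsSolution (fun _ e v => M e - N v) t₀ v e)
    {t : ℝ} (ht : t₀ ≤ t) :
    inner ℝ (P (e t)) (e t) + a * ∫ s in t₀..t, ‖e s‖ ^ 2 ≤
      ‖P‖ * ‖e t₀‖ ^ 2 + ((‖P‖ * ‖N‖) ^ 2 / a) * l2Norm t₀ v ^ 2 := by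
  have hg := he.intervalIntegrable t ht
  have hsub : ∀ s ∈ Icc t₀ t, IntervalIntegrable (fun r => M (e r) - N (v r)) volume t₀ s :=
    fun s hs => he.intervalIntegrable s hs.1
  obtain ⟨hint, heq⟩ := intervalIntegral_inner_add_inner (x := fun s => P (e s)) (y := e)
    (f := fun s => P (M (e s) - N (v s))) ht
    ⟨P.integrable_comp hg.1, P.integrable_comp hg.2⟩ hg
    (fun s hs => by
      rw [P.intervalIntegral_comp_comm (hsub s hs), ← map_add, ← he.integral_eq s hs.1])
    (fun s hs => he.integral_eq s hs.1)
  have heint : IntervalIntegrable (fun s => ‖e s‖ ^ 2) volume t₀ t := by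
    refine ContinuousOn.intervalIntegrable ?_
    rw [uIcc_of_le ht]
    exact (he.continuousOn.mono Icc_subset_Ici_self).norm.pow 2
  have hvint := hv.intervalIntegrable_sq ht
  -- The Lyapunov inequality contributes -2a‖e‖². Young's inequality spends one a‖e‖² on the cross
  -- term 2‖P‖‖N‖‖e‖‖v‖, at the cost of the stated multiple of ‖v‖².
  have hpt : ∀ s, inner ℝ (P (M (e s) - N (v s))) (e s) +
      inner ℝ (P (e s)) (M (e s) - N (v s)) ≤
      -a * ‖e s‖ ^ 2 + ((‖P‖ * ‖N‖) ^ 2 / a) * ‖v s‖ ^ 2 := by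
    intro s
    have h1 : inner ℝ (P (M (e s) - N (v s))) (e s) =
        inner ℝ (P (e s)) (M (e s) - N (v s)) := by
      rw [hP, real_inner_comm]
    have h2 : -inner ℝ (P (e s)) (N (v s)) ≤ ‖P‖ * ‖N‖ * (‖e s‖ * ‖v s‖) := by
      calc -inner ℝ (P (e s)) (N (v s)) ≤ ‖P (e s)‖ * ‖N (v s)‖ :=
            (neg_le_abs _).trans (abs_real_inner_le_norm _ _)
        _ ≤ (‖P‖ * ‖e s‖) * (‖N‖ * ‖v s‖) := by
            gcongr
            · exact P.le_opNorm _
            · exact N.le_opNorm _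
        _ = _ := by ring
    have h3 := hM (e s)
    rw [h1, inner_sub_right]
    have h4 : 2 * (‖P‖ * ‖N‖ * (‖e s‖ * ‖v s‖)) ≤
        a * ‖e s‖ ^ 2 + ((‖P‖ * ‖N‖) ^ 2 / a) * ‖v s‖ ^ 2 := by
      have h5 : a * ‖e s‖ ^ 2 + ((‖P‖ * ‖N‖) ^ 2 / a) * ‖v s‖ ^ 2 -
          2 * (‖P‖ * ‖N‖ * (‖e s‖ * ‖v s‖)) =
          (a * ‖e s‖ - ‖P‖ * ‖N‖ * ‖v s‖) ^ 2 / a := by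
        field_simp
        ring
      have : 0 ≤ (a * ‖e s‖ - ‖P‖ * ‖N‖ * ‖v s‖) ^ 2 / a := by positivity
      linarith
    linarith
  have hmono := intervalIntegral.integral_mono_on ht hint
    ((heint.const_mul (-a)).add (hvint.const_mul ((‖P‖ * ‖N‖) ^ 2 / a))) fun s _ => hpt s
  rw [heq, intervalIntegral.integral_add (heint.const_mul (-a)) (hvint.const_mul _),
    intervalIntegral.integral_const_mul, intervalIntegral.integral_const_mul] at hmono
  have h0 : inner ℝ (P (e t₀)) (e t₀) ≤ ‖P‖ * ‖e t₀‖ ^ 2 := by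
    calc inner ℝ (P (e t₀)) (e t₀) ≤ ‖P (e t₀)‖ * ‖e t₀‖ := real_inner_le_norm _ _
      _ ≤ ‖P‖ * ‖e t₀‖ * ‖e t₀‖ := by gcongr; exact P.le_opNorm _
      _ = _ := by ring
  have hvle := mul_le_mul_of_nonneg_left (hv.intervalIntegral_sq_le ht)
    (show 0 ≤ (‖P‖ * ‖N‖) ^ 2 / a by positivity)
  linarith

theorem IsSolution.hasDerivAt_of_zero_input
    (he : IsSolution (fun _ e v => M e - N v) t₀ (fun _ => (0 : V)) e) {t : ℝ} (ht : t₀ < t) :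
    HasDerivAt e (M (e t)) t := by
  have hc : ContinuousOn (fun s => M (e s) - N 0) (Ioi t₀) := by
    have := M.continuous.comp_continuousOn (he.continuousOn.mono Ioi_subset_Ici_self)
    exact this.sub continuousOn_const
  have h1 := (intervalIntegral.integral_hasDerivAt_right (he.intervalIntegrable t ht.le)
    (hc.stronglyMeasurableAtFilter isOpen_Ioi t ht) (hc.continuousAt (Ioi_mem_nhds ht))).const_add
      (e t₀)
  rw [map_zero, sub_zero] at h1
  refine h1.congr_of_eventuallyEq ?_
  filter_upwards [Ioi_mem_nhds ht] with s hs
  rw [he.integral_eq s (le_of_lt hs)]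
  simp

/-- With ρ = a / (‖P‖ + 1), exp(2ρ(t - t₀))⟨Pe, e⟩ is nonincreasing, because ρ⟨Pe, e⟩ ≤ a‖e‖² ≤
-⟨Pe, Me⟩. The 1 keeps the constants positive on the zero space, where P = 0. -/
theorem IsSolution.norm_le_of_zero_input (hP : ∀ x y, inner ℝ (P x) y = inner ℝ x (P y))
    (hb : 0 < b) (hPb : ∀ x, b * ‖x‖ ^ 2 ≤ inner ℝ (P x) x) (ha : 0 < a)
    (hM : ∀ x, inner ℝ (P x) (M x) ≤ -a * ‖x‖ ^ 2)
    (he : IsSolution (fun _ e v => M e - N v) t₀ (fun _ => (0 : V)) e) {t : ℝ} (ht : t₀ ≤ t) :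
    ‖e t‖ ≤ Real.sqrt ((‖P‖ + 1) / b) * Real.exp (-(a / (‖P‖ + 1)) * (t - t₀)) * ‖e t₀‖ := by
  have hp : 0 < ‖P‖ + 1 := by positivity
  set ρ := a / (‖P‖ + 1) with hρ
  have hPle : ∀ x, inner ℝ (P x) x ≤ (‖P‖ + 1) * ‖x‖ ^ 2 := by
    intro x
    calc inner ℝ (P x) x ≤ ‖P x‖ * ‖x‖ := real_inner_le_norm _ _
      _ ≤ ‖P‖ * ‖x‖ * ‖x‖ := by gcongr; exact P.le_opNorm _
      _ ≤ _ := by nlinarith [sq_nonneg ‖x‖]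
  have hanti : AntitoneOn (fun s => Real.exp (2 * ρ * (s - t₀)) * inner ℝ (P (e s)) (e s))
      (Ici t₀) := by
    have hder : ∀ s, t₀ < s → HasDerivAt
        (fun s => Real.exp (2 * ρ * (s - t₀)) * inner ℝ (P (e s)) (e s))
        (Real.exp (2 * ρ * (s - t₀)) * (2 * ρ) * inner ℝ (P (e s)) (e s) +
          Real.exp (2 * ρ * (s - t₀)) *
            (inner ℝ (P (e s)) (M (e s)) + inner ℝ (P (M (e s))) (e s))) s := by
      intro s hs
      have h1 := he.hasDerivAt_of_zero_input hs
      have h2 : HasDerivAt (fun s => P (e s)) (P (M (e s))) s := P.hasFDerivAt.comp_hasDerivAt s h1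
      have h3 : HasDerivAt (fun s => Real.exp (2 * ρ * (s - t₀)))
          (Real.exp (2 * ρ * (s - t₀)) * (2 * ρ)) s := by
        simpa using (((hasDerivAt_id s).sub_const t₀).const_mul (2 * ρ)).exp
      exact h3.mul (h2.inner ℝ h1)
    refine antitoneOn_of_deriv_nonpos (convex_Ici t₀) ?_ ?_ ?_
    · have := P.continuous.comp_continuousOn he.continuousOn
      exact (by fun_prop : Continuous fun s => Real.exp (2 * ρ * (s - t₀))).continuousOn.mul
        (this.inner he.continuousOn)
    · intro s hs
      rw [interior_Ici] at hs
      exact (hder s hs).differentiableAt.differentiableWithinAt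
    · intro s hs
      rw [interior_Ici] at hs
      rw [(hder s hs).deriv, hP (M (e s)), real_inner_comm (P (e s)) (M (e s))]
      have h1 := hM (e s)
      have h2 : ρ * inner ℝ (P (e s)) (e s) ≤ a * ‖e s‖ ^ 2 := by
        calc ρ * inner ℝ (P (e s)) (e s) ≤ ρ * ((‖P‖ + 1) * ‖e s‖ ^ 2) := by
              gcongr
              exact hPle _
          _ = _ := by rw [hρ]; field_simp
      have h3 := (Real.exp_pos (2 * ρ * (s - t₀))).le
      have h4 := mul_nonneg h3
        (sub_nonneg.2 (h2.trans (by linarith : _ ≤ -inner ℝ (P (e s)) (M (e s)))))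
      linarith
  have h1 := hanti self_mem_Ici ht ht
  simp only [sub_self, mul_zero, Real.exp_zero, one_mul] at h1
  have h2 := h1.trans (hPle (e t₀))
  have h3 : Real.exp (2 * ρ * (t - t₀)) * (b * ‖e t‖ ^ 2) ≤ (‖P‖ + 1) * ‖e t₀‖ ^ 2 :=
    (mul_le_mul_of_nonneg_left (hPb (e t)) (Real.exp_pos _).le).trans h2
  refine le_of_sq_le_sq ?_ (by positivity)
  rw [mul_pow, mul_pow, Real.sq_sqrt (by positivity), ← Real.exp_nat_mul]
  have h4 : Real.exp (2 * ρ * (t - t₀)) * Real.exp ((2 : ℕ) * (-ρ * (t - t₀))) = 1 := by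
    rw [← Real.exp_add, ← Real.exp_zero]
    congr 1
    push_cast
    ring
  have h5 := mul_le_mul_of_nonneg_right h3 (Real.exp_pos ((2 : ℕ) * (-ρ * (t - t₀)))).le
  rw [div_mul_eq_mul_div, div_mul_eq_mul_div, le_div_iff₀ hb]
  calc ‖e t‖ ^ 2 * b = Real.exp (2 * ρ * (t - t₀)) * Real.exp ((2 : ℕ) * (-ρ * (t - t₀))) *
        (‖e t‖ ^ 2 * b) := by rw [h4, one_mul]
    _ ≤ _ := by linarith

/-- A linear system with a quadratic Lyapunov function is `L₂`-stable. -/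
theorem isL2Stable_of_lyapunov (hP : ∀ x y, inner ℝ (P x) y = inner ℝ x (P y))
    (hb : 0 < b) (hPb : ∀ x, b * ‖x‖ ^ 2 ≤ inner ℝ (P x) x) (ha : 0 < a)
    (hM : ∀ x, inner ℝ (P x) (M x) ≤ -a * ‖x‖ ^ 2) (H : E →L[ℝ] Z) :
    IsL2Stable (fun _ e (v : V) => M e - N v) (fun _ e (_ : V) => H e)
      (‖H‖ * Real.sqrt (((‖P‖ * ‖N‖) ^ 2 / a) / a)) where
  nonneg := by positivity
  exists_solution t₀ e₀ v hv := exists_isSolution_linear M N t₀ e₀ hv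
  exponentially_stable := ⟨Real.sqrt ((‖P‖ + 1) / b), a / (‖P‖ + 1), by positivity, by positivity,
    fun _ _ he _ ht => he.norm_le_of_zero_input hP hb hPb ha hM ht⟩
  bounded_state := by
    -- The energy inequality with the nonnegative integral dropped.
    refine ⟨fun x r => Real.sqrt ((‖P‖ * ‖x‖ ^ 2 + ((‖P‖ * ‖N‖) ^ 2 / a) * r ^ 2) / b),
      fun t₀ v hv e he t ht => Real.le_sqrt_of_sq_le ?_⟩
    have h1 := he.energy_le hP ha hM hv ht
    have h2 : 0 ≤ ∫ s in t₀..t, ‖e s‖ ^ 2 :=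
      intervalIntegral.integral_nonneg ht fun _ _ => by positivity
    rw [le_div_iff₀ hb]
    linarith [hPb (e t), mul_nonneg ha.le h2]
  output_response := by
    -- The energy inequality with ⟨Pe, e⟩ ≥ 0 dropped. At x = 0 the bound is linear in r, and its
    -- slope is the performance level.
    refine ⟨fun x r => ‖H‖ * Real.sqrt ((‖P‖ * ‖x‖ ^ 2 + ((‖P‖ * ‖N‖) ^ 2 / a) * r ^ 2) / a),
      fun t₀ v hv e he => ?_, fun t₀ v _ => ?_⟩
    · obtain ⟨h1, h2⟩ := isL2Signal_of_intervalIntegral_sq_le he.continuousOn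
        (K := (‖P‖ * ‖e t₀‖ ^ 2 + ((‖P‖ * ‖N‖) ^ 2 / a) * l2Norm t₀ v ^ 2) / a) fun t ht => by
          have h1 := he.energy_le hP ha hM hv ht
          rw [le_div_iff₀ ha]
          have : 0 ≤ b * ‖e t‖ ^ 2 := by positivity
          linarith [hPb (e t)]
      have hHe : IsL2Signal t₀ fun t => H (e t) := H.comp_memLp' h1
      refine ⟨hHe, ?_⟩
      have h3 : l2Norm t₀ (fun t => H (e t)) ≤ ‖H‖ * l2Norm t₀ e := by
        refine Real.sqrt_le_iff.2 ⟨mul_nonneg (norm_nonneg _) (Real.sqrt_nonneg _), ?_⟩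
        rw [mul_pow, sq_l2Norm, ← integral_const_mul]
        refine integral_mono hHe.integrableOn_sq (h1.integrableOn_sq.const_mul _) fun s => ?_
        simp only
        rw [← mul_pow]
        gcongr
        exact H.le_opNorm _
      exact h3.trans (mul_le_mul_of_nonneg_left (Real.le_sqrt_of_sq_le h2) (norm_nonneg _))
    · have hr : 0 ≤ l2Norm t₀ v := Real.sqrt_nonneg _
      beta_reduce
      rw [norm_zero, zero_pow two_ne_zero, mul_zero, zero_add, mul_div_right_comm,
        Real.sqrt_mul (by positivity), Real.sqrt_sq hr, mul_assoc]

end LinearSystems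

/-- A continuous, 2-homogeneous, positive function dominates a multiple of the squared norm. -/
theorem exists_pos_mul_sq_norm_le {E : Type*} [NormedAddCommGroup E] [NormedSpace ℝ E]
    [FiniteDimensional ℝ E] {q : E → ℝ} (hq : Continuous q)
    (hhom : ∀ (r : ℝ) x, q (r • x) = r ^ 2 * q x) (hpos : ∀ x, x ≠ 0 → 0 < q x) :
    ∃ a, 0 < a ∧ ∀ x, a * ‖x‖ ^ 2 ≤ q x := by
  have hq0 : q 0 = 0 := by simpa using hhom 0 0
  -- On the zero space the unit sphere is empty and offers no minimiser.
  rcases subsingleton_or_nontrivial E with hE | hE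
  · exact ⟨1, one_pos, fun x => by rw [Subsingleton.elim x 0, hq0]; simp⟩
  obtain ⟨x₀, hx₀, hmin⟩ := (isCompact_sphere (0 : E) 1).exists_isMinOn
    (NormedSpace.sphere_nonempty.2 zero_le_one) hq.continuousOn
  refine ⟨q x₀, hpos x₀ (ne_zero_of_mem_unit_sphere ⟨x₀, hx₀⟩), fun x => ?_⟩
  rcases eq_or_ne x 0 with rfl | hx
  · simp [hq0]
  have hn : ‖x‖ ≠ 0 := norm_ne_zero_iff.2 hx
  have h1 : q x₀ ≤ q (‖x‖⁻¹ • x) := hmin (by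
    rw [mem_sphere_zero_iff_norm, norm_smul, norm_inv, norm_norm, inv_mul_cancel₀ hn])
  calc q x₀ * ‖x‖ ^ 2 ≤ q (‖x‖⁻¹ • x) * ‖x‖ ^ 2 := by gcongr
    _ = q x := by rw [hhom]; field_simp

end Stability

/-! ### Choice of the observer gain -/

theorem mainTheorem3 (nx nm nw nv ny nz : ℕ)
    (A : Matrix (Fin nx) (Fin nx) ℝ) (B : Matrix (Fin nx) (Fin nw) ℝ)
    (C : Matrix (Fin ny) (Fin nx) ℝ) (D : Matrix (Fin ny) (Fin nw) ℝ)
    (Am : Matrix (Fin nm) (Fin nm) ℝ) (Bm : Matrix (Fin nm) (Fin nv) ℝ)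
    (Cm : Matrix (Fin nw) (Fin nm) ℝ) (Dm : Matrix (Fin nw) (Fin nv) ℝ)
    (hAC : IsDetectable A C) (hAmCm : IsDetectable Am Cm)
    (hrank : RankConditionAtUnstableModes A B C D Am)
    (H : Matrix (Fin nz) (Fin nx ⊕ Fin nm) ℝ) :
    ∃ (L₁ : Matrix (Fin nx ⊕ Fin nm) (Fin ny) ℝ) (gam : ℝ),
      IsL2Stable
        (errorField (augA A B Am Cm) (augB B Bm Dm) (augC C D Cm) (augD D Dm) L₁)
        (performanceOutput (r := Fin nv) H) gam := by
  obtain ⟨P, L, hP, hneg⟩ := (isDetectable_augmented A B C D Am Cm hAC hAmCm hrank).exists_lyapunov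
  let toCLM {m n : Type} [Fintype m] [Fintype n] [DecidableEq n] (M : Matrix m n ℝ) :
      EuclideanSpace ℝ n →L[ℝ] EuclideanSpace ℝ m :=
    LinearMap.toContinuousLinearMap (Matrix.toEuclideanLin M)
  have hPT : P.transpose = P := by
    simpa [Matrix.conjTranspose_eq_transpose_of_trivial] using hP.1.eq
  have hinner : ∀ x y, inner ℝ (toCLM P x) y = x.ofLp ⬝ᵥ Matrix.mulVec P y.ofLp := by
    intro x y
    rw [EuclideanSpace.inner_eq_star_dotProduct, star_trivial, Matrix.dotProduct_mulVec,
      ← Matrix.mulVec_transpose, hPT, dotProduct_comm]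
    rfl
  have hsymm : ∀ x y, inner ℝ (toCLM P x) y = inner ℝ x (toCLM P y) := by
    intro x y
    rw [hinner, real_inner_comm, hinner, Matrix.dotProduct_mulVec, ← Matrix.mulVec_transpose, hPT,
      dotProduct_comm]
  set M := augA A B Am Cm + L * augC C D Cm
  -- Compactness of the sphere upgrades the two strict inequalities for P and PM to the uniform
  -- constants b and a.
  obtain ⟨b, hb, hPb⟩ := exists_pos_mul_sq_norm_le
    (q := fun x : EuclideanSpace ℝ (Fin nx ⊕ Fin nm) => inner ℝ (toCLM P x) x)
    (by fun_prop)
    (fun r x => by rw [map_smul, real_inner_smul_left, real_inner_smul_right]; ring)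
    (fun x hx => by
      rw [hinner]
      simpa using hP.dotProduct_mulVec_pos (x := x.ofLp) (by simpa using hx))
  obtain ⟨a, ha, hMa⟩ := exists_pos_mul_sq_norm_le
    (q := fun x : EuclideanSpace ℝ (Fin nx ⊕ Fin nm) => -inner ℝ (toCLM P x) (toCLM M x))
    (by fun_prop)
    (fun r x => by rw [map_smul, map_smul, real_inner_smul_left, real_inner_smul_right]; ring)
    (fun x hx => by
      have h1 := hneg x.ofLp (by simpa using hx)
      rw [← Matrix.mulVec_mulVec] at h1
      rw [hinner, neg_pos]
      exact h1)
  exact ⟨L, _, isL2Stable_of_lyapunov (N := toCLM (augB B Bm Dm + L * augD D Dm))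
    (M := toCLM M) hsymm hb hPb ha (fun x => by linarith [hMa x]) (toCLM H)⟩
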